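/- **Conventions.** A *distributive bilattice* is an algebra $\mathbf A=(A;\lor_t,\land_t,\neg,0_t,1_t,0_k,1_k)$ such that, with $$a\lor_k b=((a\land_t b)\land_t 0_k)\lor_t((a\lor_t b)\land_t 1_k),\qquad a\land_k b=((a\land_t b)\land_t 1_k)\lor_t((a\lor_t b)\land_t 0_k),$$ $(A;\lor_t,\land_t,0_t,1_t)$ and $(A;\lor_k,\land_k,0_k,1_k)$ are bounded lattices, each of the four operations $\lor_t,\land_t,\lor_k,\land_k$ distributes over each of the other three, and $\neg$ is an involution that is a dual endomorphism of the first bounded lattice, $\mathbf A_t$, and an endomorphism of the second one. Let $\mathcal{DB}$ be the category of distributive bilattices, $\mathcal D$ the category of bounded distributive lattices (in both cases with the homomorphisms, preserving the constants, as morphisms), and $\mathcal P$ the category of Priestley spaces and continuous order-preserving maps. Let $\mathbf 2$ be the two-element chain in $\mathcal D$ and $\underset{\sim}{\mathbf 2}$ the same ordered set with the discrete topology. Let $\mathbf 4\in\mathcal{DB}$ have universe $\{00,01,10,11\}$, where the truth order is the componentwise order of binary strings, $0_t=00$, $1_t=11$, $0_k=01$, $1_k=10$, and $\neg$ interchanges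 $00$ and $11$ and fixes $01$ and $10$; let $\underset{\sim}{\mathbf 4}$ be $\{00,01,10,11\}$ with the knowledge order ($a\le_k b$ iff $a\land_k b=a$) and the discrete topology. Consider the contravariant hom-functors $$H=\mathcal D(-,\mathbf 2)\colon\mathcal D\to\mathcal P,\quad K=\mathcal P(-,\underset{\sim}{\mathbf 2})\colon\mathcal P\to\mathcal D,\quad D=\mathcal{DB}(-,\mathbf 4)\colon\mathcal{DB}\to\mathcal P,\quad E=\mathcal P(-,\underset{\sim}{\mathbf 4})\colon\mathcal P\to\mathcal{DB},$$ acting on morphisms by composition, where $H(\mathbf L)$ and $D(\mathbf A)$ carry the pointwise order and the subspace topology from $\underset{\sim}{\mathbf 2}^{L}$ and $\underset{\sim}{\mathbf 4}^{A}$, and the operations of $K(X)$ and $E(X)$ are pointwise those of $\mathbf 2$ and $\mathbf 4$. For $\mathbf L\in\mathcal D$ let $\mathbf L\odot\mathbf L\in\mathcal{DB}$ have universe $L\times L$ and operations $$(a_1,a_2)\lor_t(b_1,b_2)=(a_1\lor b_1,a_2\land b_2),\quad (a_1,a_2)\land_t(b_1,b_2)=(a_1\land b_1,a_2\lor b_2),\quad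 \neg(a_1,a_2)=(a_2,a_1),$$ $0_t=(0,1)$, $1_t=(1,0)$, $0_k=(0,0)$, $1_k=(1,1)$ (so that $\lor_k,\land_k$ are componentwise $\lor,\land$). **Theorem.** Let $V\colon\mathcal{DB}\to\mathcal D$ and $W\colon\mathcal D\to\mathcal{DB}$ be the functors defined as follows. $V(\mathbf A)$ is the interval $[0_k,1_t]=\{a\in A: 0_k\le_t a\le_t 1_t\}$, considered as a sublattice of $\mathbf A_t$ with bounds $0_k$ and $1_t$, and $V(h)=h{\restriction}_{[0_k,1_t]}$; $W(\mathbf L)=\mathbf L\odot\mathbf L$, and $W(g)\colon(a,b)\mapsto(g(a),g(b))$. Then $V$ is naturally equivalent (isomorphic) to $KD$ and $W$ is naturally equivalent to $EH$. Hence $V$ and $W$ give a categorical equivalence between $\mathcal{DB}$ and $\mathcal D$: they are mutually quasi-inverse. -/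

import Mathlib

open CategoryTheory

universe u v w

noncomputable section

namespace Bilat

/-! ### Distributive bilattices -/

/-- `(A; s, i)` is a lattice (join `s`, meet `i`), presented by equations. -/
structure IsLatticeOps {A : Type u} (s i : A → A → A) : Prop where
  sup_comm : ∀ a b, s a b = s b a
  inf_comm : ∀ a b, i a b = i b a
  sup_assoc : ∀ a b c, s (s a b) c = s a (s b c)
  inf_assoc : ∀ a b c, i (i a b) c = i a (i b c)
  sup_inf_self : ∀ a b, s a (i a b) = a
  inf_sup_self : ∀ a b, i a (s a b) = a

/-- The operation `f` distributes over the operation `g`. -/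
def Distributes {A : Type u} (f g : A → A → A) : Prop :=
  ∀ a b c, f a (g b c) = g (f a b) (f a c)

/-- `(A; sT, iT, sK, iK)` is an unbounded distributive pre-bilattice: both pairs of operations
are lattice operations, and each of the four operations distributes over each of the
other three. -/
structure IsDistribPreBilattice {A : Type u} (sT iT sK iK : A → A → A) : Prop where
  lattice_t : IsLatticeOps sT iT
  lattice_k : IsLatticeOps sK iK
  sT_iT : Distributes sT iT
  sT_sK : Distributes sT sK
  sT_iK : Distributes sT iK
  iT_sT : Distributes iT sT
  iT_sK : Distributes iT sK
  iT_iK : Distributes iT iK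
  sK_sT : Distributes sK sT
  sK_iT : Distributes sK iT
  sK_iK : Distributes sK iK
  iK_sT : Distributes iK sT
  iK_iT : Distributes iK iT
  iK_sK : Distributes iK sK

/-- The operations of a distributive bilattice.  The truth lattice `(A; ∨ₜ, ∧ₜ, 0ₜ, 1ₜ)` is
carried by the Mathlib structure `(A; ⊔, ⊓, ⊥, ⊤)` (so `≤` is the truth order); in addition there
are the knowledge constants `0ₖ = botK`, `1ₖ = topK` and the negation `neg`. -/
class BilatticeOps (A : Type u) extends DistribLattice A, BoundedOrder A where
  botK : A
  topK : A
  neg : A → A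

open BilatticeOps (botK topK neg)

section Ops

variable {A : Type u} [BilatticeOps A]

/-- Knowledge join, `a ∨ₖ b = ((a ∧ₜ b) ∧ₜ 0ₖ) ∨ₜ ((a ∨ₜ b) ∧ₜ 1ₖ)`. -/
def supK (a b : A) : A := ((a ⊓ b) ⊓ botK) ⊔ ((a ⊔ b) ⊓ topK)

/-- Knowledge meet, `a ∧ₖ b = ((a ∧ₜ b) ∧ₜ 1ₖ) ∨ₜ ((a ∨ₜ b) ∧ₜ 0ₖ)`. -/
def infK (a b : A) : A := ((a ⊓ b) ⊓ topK) ⊔ ((a ⊔ b) ⊓ botK)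

end Ops

/-- Distributive bilattices (algebras of the variety DB, in the language
`∨ₜ, ∧ₜ, ¬, 0ₜ, 1ₜ, 0ₖ, 1ₖ`): with `∨ₖ, ∧ₖ` defined as above, the four lattice operations form an
unbounded distributive pre-bilattice, `0ₖ, 1ₖ` are the bounds of the knowledge lattice
(`0ₜ, 1ₜ` are those of the truth lattice), and `¬` is an involution which is a dual endomorphism
of the bounded truth lattice and an endomorphism of the bounded knowledge lattice. -/
class DistribBilattice (A : Type u) extends BilatticeOps A where
  preBilattice : IsDistribPreBilattice (A := A) (· ⊔ ·) (· ⊓ ·) supK infK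
  supK_botK : ∀ a : A, supK a botK = a
  infK_topK : ∀ a : A, infK a topK = a
  neg_neg : ∀ a : A, neg (neg a) = a
  neg_sup : ∀ a b : A, neg (a ⊔ b) = neg a ⊓ neg b
  neg_inf : ∀ a b : A, neg (a ⊓ b) = neg a ⊔ neg b
  neg_bot : neg (⊥ : A) = ⊤
  neg_top : neg (⊤ : A) = ⊥
  neg_supK : ∀ a b : A, neg (supK a b) = supK (neg a) (neg b)
  neg_infK : ∀ a b : A, neg (infK a b) = infK (neg a) (neg b)
  neg_botK : neg (botK : A) = botK
  neg_topK : neg (topK : A) = topK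

/-- The knowledge order of a distributive bilattice: `a ≤ₖ b` iff `a ∧ₖ b = a`. -/
@[reducible]
def kOrder (A : Type u) [DistribBilattice A] : PartialOrder A where
  le a b := infK a b = a
  lt a b := infK a b = a ∧ ¬ infK b a = b
  lt_iff_le_not_ge _ _ := Iff.rfl
  le_refl a := by
    have h := (DistribBilattice.preBilattice (A := A)).lattice_k
    have h1 := h.inf_sup_self a (infK a a)
    rwa [h.sup_inf_self] at h1
  le_trans a b c hab hbc := by
    have h := (DistribBilattice.preBilattice (A := A)).lattice_k
    change infK a c = a
    rw [← hab, h.inf_assoc, show infK b c = b from hbc]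
  le_antisymm a b hab hba := by
    have h := (DistribBilattice.preBilattice (A := A)).lattice_k
    rw [← (show infK a b = a from hab), h.inf_comm, show infK b a = b from hba]

/-- Homomorphisms of distributive bilattices: maps preserving all the basic operations
`∨ₜ, ∧ₜ, ¬, 0ₜ, 1ₜ, 0ₖ, 1ₖ`. -/
structure BilatHom (A : Type u) (B : Type v) [DistribBilattice A] [DistribBilattice B]
    extends BoundedLatticeHom A B where
  map_neg' : ∀ a, toFun (neg a) = neg (toFun a)
  map_botK' : toFun botK = botK
  map_topK' : toFun topK = topK

namespace BilatHom

variable {A : Type u} {B : Type v} {C : Type w}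
  [DistribBilattice A] [DistribBilattice B] [DistribBilattice C]

instance : FunLike (BilatHom A B) A B where
  coe f := f.toFun
  coe_injective f g h := by
    obtain ⟨f, _, _, _⟩ := f
    obtain ⟨g, _, _, _⟩ := g
    have : f = g := DFunLike.coe_injective h
    subst this
    rfl

instance : BoundedLatticeHomClass (BilatHom A B) A B where
  map_sup f := f.map_sup'
  map_inf f := f.map_inf'
  map_top f := f.map_top'
  map_bot f := f.map_bot'

@[ext]
theorem ext {f g : BilatHom A B} (h : ∀ a, f a = g a) : f = g := DFunLike.ext f g h

theorem map_neg (f : BilatHom A B) (a : A) : f (neg a) = neg (f a) := f.map_neg' a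
theorem map_botK (f : BilatHom A B) : f botK = botK := f.map_botK'
theorem map_topK (f : BilatHom A B) : f topK = topK := f.map_topK'

/-- The identity homomorphism. -/
def id (A : Type u) [DistribBilattice A] : BilatHom A A where
  toBoundedLatticeHom := BoundedLatticeHom.id A
  map_neg' _ := rfl
  map_botK' := rfl
  map_topK' := rfl

/-- Composition of homomorphisms. -/
def comp (g : BilatHom B C) (f : BilatHom A B) : BilatHom A C where
  toBoundedLatticeHom := g.toBoundedLatticeHom.comp f.toBoundedLatticeHom
  map_neg' a := (congrArg g (f.map_neg a)).trans (g.map_neg _)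
  map_botK' := (congrArg g f.map_botK).trans g.map_botK
  map_topK' := (congrArg g f.map_topK).trans g.map_topK

@[simp] theorem id_apply (a : A) : BilatHom.id A a = a := rfl
@[simp] theorem comp_apply (g : BilatHom B C) (f : BilatHom A B) (a : A) :
    g.comp f a = g (f a) := rfl

end BilatHom

/-- The category DB of distributive bilattices and their homomorphisms. -/
structure DB : Type (u + 1) where
  of ::
  carrier : Type u
  [str : DistribBilattice carrier]

attribute [instance] DB.str

instance : CoeSort DB.{u} (Type u) := ⟨DB.carrier⟩

instance : Category DB.{u} where
  Hom A B := BilatHom A B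
  id A := BilatHom.id A
  comp f g := BilatHom.comp g f

/-! ### Priestley spaces -/

/-- The category of Priestley spaces and continuous order-preserving maps.  (Compactness is not
part of Mathlib's class `PriestleySpace`.) -/
structure Priestley : Type (u + 1) where
  of ::
  carrier : Type u
  [order : PartialOrder carrier]
  [top : TopologicalSpace carrier]
  [compact : CompactSpace carrier]
  [priestley : PriestleySpace carrier]

attribute [instance] Priestley.order Priestley.top Priestley.compact Priestley.priestley

instance : CoeSort Priestley.{u} (Type u) := ⟨Priestley.carrier⟩

instance : Category Priestley.{u} where
  Hom X Y := X →Co Y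
  id X := ContinuousOrderHom.id X
  comp f g := ContinuousOrderHom.comp g f

/-- A closed substructure of a power `Y^S` of a finite discretely topologised ordered set `Y`:
if `c : T → Y^S` is injective with closed image, then `T` with the pointwise order and the
subspace topology is a Priestley space. -/
def Priestley.ofClosed {T : Type u} {S : Type v} {Y : Type w} [PartialOrder Y]
    [TopologicalSpace Y] [DiscreteTopology Y] [Finite Y]
    (c : T → S → Y) (hc : Function.Injective c) (hcl : IsClosed (Set.range c)) :
    Priestley.{u} :=
  letI : PartialOrder T := PartialOrder.lift c hc
  letI : TopologicalSpace T := TopologicalSpace.induced c inferInstance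
  have hemb : Topology.IsClosedEmbedding c := ⟨⟨⟨rfl⟩, hc⟩, hcl⟩
  haveI : CompactSpace T := hemb.compactSpace
  haveI : PriestleySpace T := by
    refine ⟨fun {x y} hxy => ?_⟩
    have hxy' : ¬ c x ≤ c y := hxy
    obtain ⟨s, hs⟩ := not_forall.1 hxy'
    refine ⟨{t | c x s ≤ c t s}, ?_, ?_, le_rfl, hs⟩
    · exact (isClopen_discrete {y : Y | c x s ≤ y}).preimage
        ((continuous_apply s).comp hemb.continuous)
    · exact fun a b hab ha => le_trans ha ((show c a ≤ c b from hab) s)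
  Priestley.of T

/-! ### Priestley duality: the hom-functors `H` and `K` -/

/-- `H(L)`: the set of bounded lattice homomorphisms from `L` to the two-element chain, as a
closed substructure of the power `2^L` of the discretely topologised two-element chain. -/
def Hobj (L : BddDistLat.{u}) : Priestley.{u} :=
  Priestley.ofClosed (T := BoundedLatticeHom L Bool) (S := L) (Y := Bool)
    (fun x a => x a) DFunLike.coe_injective <| by
    have hr : Set.range (fun (x : BoundedLatticeHom L Bool) (a : L) => x a) =
        {f : L → Bool | f ⊥ = ⊥ ∧ f ⊤ = ⊤ ∧ ∀ a b, f (a ⊔ b) = f a ⊔ f b ∧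
          f (a ⊓ b) = f a ⊓ f b} := by
      ext f
      constructor
      · rintro ⟨x, rfl⟩
        exact ⟨map_bot x, map_top x, fun a b => ⟨map_sup x a b, map_inf x a b⟩⟩
      · rintro ⟨h0, h1, h⟩
        exact ⟨{ toFun := f, map_sup' := fun a b => (h a b).1,
                 map_inf' := fun a b => (h a b).2, map_top' := h1, map_bot' := h0 }, rfl⟩
    rw [hr]
    simp only [Set.ofPred_and, Set.ofPred_forall]
    have hev : ∀ a : L, Continuous fun f : L → Bool => f a := fun a => continuous_apply a
    have hop : ∀ (o : Bool → Bool → Bool) (a b : L),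
        Continuous fun f : L → Bool => o (f a) (f b) := fun o a b =>
      (continuous_of_discreteTopology (f := fun p : Bool × Bool => o p.1 p.2)).comp
        ((hev a).prodMk (hev b))
    refine (isClosed_eq (hev _) continuous_const).inter
      ((isClosed_eq (hev _) continuous_const).inter
        (isClosed_iInter fun a => isClosed_iInter fun b => ?_))
    exact (isClosed_eq (hev _) (hop _ a b)).inter (isClosed_eq (hev _) (hop _ a b))

/-- The functor `H = D(-, 2)`, acting on morphisms by `g ↦ - ∘ g`. -/
def H : BddDistLat.{u}ᵒᵖ ⥤ Priestley.{u} where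
  obj L := Hobj L.unop
  map {L M} g :=
    { toFun := fun x : BoundedLatticeHom L.unop Bool =>
        (x.comp (BddDistLat.Hom.hom g.unop) : BoundedLatticeHom M.unop Bool)
      monotone' := fun _ _ hxy a => hxy (BddDistLat.Hom.hom g.unop a)
      continuous_toFun := continuous_induced_rng.2 <| continuous_pi fun a =>
        (continuous_apply (BddDistLat.Hom.hom g.unop a)).comp continuous_induced_dom }
  map_id _ := rfl
  map_comp _ _ := rfl

/-- The underlying set of `K(X)`: the continuous order-preserving maps from `X` to the discretely
topologised two-element chain. -/
def KCarrier (X : Priestley.{u}) : Type u := X →Co Bool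

namespace KCarrier

variable {X : Priestley.{u}}

instance : FunLike (KCarrier X) X Bool := inferInstanceAs (FunLike (X →Co Bool) X Bool)

/-- The pointwise application of a monotone binary operation. -/
def map₂ (o : Bool → Bool → Bool) (ho : ∀ a b c d, a ≤ b → c ≤ d → o a c ≤ o b d)
    (f g : KCarrier X) : KCarrier X where
  toFun x := o (f x) (g x)
  monotone' _ _ h := ho _ _ _ _ (f.monotone' h) (g.monotone' h)
  continuous_toFun := (continuous_of_discreteTopology (f := fun p : Bool × Bool => o p.1 p.2)).comp
    (f.continuous_toFun.prodMk g.continuous_toFun)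

/-- Constant maps. -/
def const (b : Bool) : KCarrier X where
  toFun _ := b
  monotone' _ _ _ := le_rfl
  continuous_toFun := continuous_const

/-- `K(X)` is a sublattice of the power `2^X`: the operations are pointwise. -/
instance : DistribLattice (KCarrier X) where
  sup := map₂ (· ⊔ ·) fun _ _ _ _ => sup_le_sup
  inf := map₂ (· ⊓ ·) fun _ _ _ _ => inf_le_inf
  le f g := ∀ x, f x ≤ g x
  le_refl _ _ := le_rfl
  le_trans _ _ _ h h' x := (h x).trans (h' x)
  le_antisymm _ _ h h' := DFunLike.ext _ _ fun x => (h x).antisymm (h' x)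
  le_sup_left _ _ _ := le_sup_left (α := Bool)
  le_sup_right _ _ _ := le_sup_right (α := Bool)
  sup_le _ _ _ h h' x := sup_le (α := Bool) (h x) (h' x)
  inf_le_left _ _ _ := inf_le_left (α := Bool)
  inf_le_right _ _ _ := inf_le_right (α := Bool)
  le_inf _ _ _ h h' x := le_inf (α := Bool) (h x) (h' x)
  le_sup_inf _ _ _ _ := le_sup_inf (α := Bool)

instance : BoundedOrder (KCarrier X) where
  bot := const ⊥
  top := const ⊤
  bot_le _ _ := bot_le (α := Bool)
  le_top _ _ := le_top (α := Bool)

end KCarrier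

/-- The functor `K = P(-, 2)` from Priestley spaces to bounded distributive lattices, acting on
morphisms by `φ ↦ - ∘ φ`. -/
def K : Priestley.{u}ᵒᵖ ⥤ BddDistLat.{u} where
  obj X := BddDistLat.of (KCarrier X.unop)
  map {X Y} φ := BddDistLat.ofHom
    { toFun := fun f : X.unop →Co Bool =>
        (f.comp (show Y.unop →Co X.unop from φ.unop) : Y.unop →Co Bool)
      map_sup' := fun _ _ => rfl
      map_inf' := fun _ _ => rfl
      map_top' := rfl
      map_bot' := rfl }
  map_id _ := rfl
  map_comp _ _ := rfl

/-! ### The four-element bilattice and the natural duality: the hom-functors `D` and `E` -/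

/-- The universe `{00, 01, 10, 11}` of the four-element bilattice, as binary strings. -/
def Four : Type := Bool × Bool

instance : DecidableEq Four := inferInstanceAs (DecidableEq (Bool × Bool))
instance : Fintype Four := inferInstanceAs (Fintype (Bool × Bool))
instance : DistribLattice Four := inferInstanceAs (DistribLattice (Bool × Bool))
instance : BoundedOrder Four := inferInstanceAs (BoundedOrder (Bool × Bool))

/-- The four-element distributive bilattice: the truth order is the componentwise order of
`{0,1}²` (so `0ₜ = 00`, `1ₜ = 11`), `0ₖ = 01`, `1ₖ = 10`, and `¬` switches `00` and `11` and
fixes `01` and `10`. -/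
instance : BilatticeOps Four where
  botK := (false, true)
  topK := (true, false)
  neg a := (!a.2, !a.1)

instance : DistribBilattice Four where
  preBilattice := by
    constructor
    · constructor <;> decide
    · constructor <;> decide
    all_goals unfold Distributes; decide
  supK_botK := by decide
  infK_topK := by decide
  neg_neg := by decide
  neg_sup := by decide
  neg_inf := by decide
  neg_bot := by decide
  neg_top := by decide
  neg_supK := by decide
  neg_infK := by decide
  neg_botK := by decide
  neg_topK := by decide

/-- The alter ego of the four-element bilattice: the same universe with the knowledge order and
the discrete topology. -/
def FourK : Type := Four

instance : PartialOrder FourK := kOrder Four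
instance : TopologicalSpace FourK := ⊥
instance : DiscreteTopology FourK := ⟨rfl⟩
instance : Finite FourK := inferInstanceAs (Finite Four)

/-- `D(A)`: the set of homomorphisms from `A` to the four-element bilattice, as a closed
substructure of the power `FourK^A` of the alter ego. -/
def Dobj (A : DB.{u}) : Priestley.{u} :=
  Priestley.ofClosed (T := BilatHom A Four) (S := A) (Y := FourK)
    (fun x a => (x a : Four)) DFunLike.coe_injective <| by
    have hr : Set.range (fun (x : BilatHom A Four) (a : A) => (x a : Four)) =
        {f : A → Four | f ⊥ = ⊥ ∧ f ⊤ = ⊤ ∧ f botK = botK ∧ f topK = topK ∧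
          (∀ a, f (neg a) = neg (f a)) ∧ ∀ a b, f (a ⊔ b) = f a ⊔ f b ∧
          f (a ⊓ b) = f a ⊓ f b} := by
      ext f
      constructor
      · rintro ⟨x, rfl⟩
        exact ⟨map_bot x, map_top x, x.map_botK, x.map_topK, x.map_neg,
          fun a b => ⟨map_sup x a b, map_inf x a b⟩⟩
      · rintro ⟨h0, h1, hb, ht, hn, h⟩
        exact ⟨{ toFun := f, map_sup' := fun a b => (h a b).1,
                 map_inf' := fun a b => (h a b).2, map_top' := h1, map_bot' := h0,
                 map_neg' := hn, map_botK' := hb, map_topK' := ht }, rfl⟩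
    have hev : ∀ a : A, Continuous fun f : A → FourK => f a := fun a => continuous_apply a
    have hop : ∀ (o : FourK → FourK → FourK) (a b : A),
        Continuous fun f : A → FourK => o (f a) (f b) := fun o a b =>
      (continuous_of_discreteTopology (f := fun p : FourK × FourK => o p.1 p.2)).comp
        ((hev a).prodMk (hev b))
    have hun : ∀ (o : FourK → FourK) (a : A), Continuous fun f : A → FourK => o (f a) :=
      fun o a => (continuous_of_discreteTopology (f := o)).comp (hev a)
    have key : ∀ (b0 b1 k0 k1 : FourK) (n : FourK → FourK) (s i : FourK → FourK → FourK),
          IsClosed {f : A → FourK | f ⊥ = b0 ∧ f ⊤ = b1 ∧ f botK = k0 ∧ f topK = k1 ∧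
          (∀ a, f (neg a) = n (f a)) ∧ ∀ a b, f (a ⊔ b) = s (f a) (f b) ∧
          f (a ⊓ b) = i (f a) (f b)} := by
      intro b0 b1 k0 k1 n s i
      simp only [Set.ofPred_and, Set.ofPred_forall]
      refine (isClosed_eq (hev _) continuous_const).inter
        ((isClosed_eq (hev _) continuous_const).inter
        ((isClosed_eq (hev _) continuous_const).inter
        ((isClosed_eq (hev _) continuous_const).inter
        ((isClosed_iInter fun a => isClosed_eq (hev _)
          (hun n a)).inter
        (isClosed_iInter fun a => isClosed_iInter fun b => ?_)))))
      exact (isClosed_eq (hev _) (hop s a b)).inter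
        (isClosed_eq (hev _) (hop i a b))
    have h := key (⊥ : Four) (⊤ : Four) (botK : Four) (topK : Four) (neg : Four → Four)
      ((· ⊔ ·) : Four → Four → Four) ((· ⊓ ·) : Four → Four → Four)
    exact Eq.mpr (congrArg (fun t : Set (A → FourK) => IsClosed t) hr) h

/-- The functor `D = DB(-, 4)`, acting on morphisms by `h ↦ - ∘ h`. -/
def D : DB.{u}ᵒᵖ ⥤ Priestley.{u} where
  obj A := Dobj A.unop
  map {A B} h :=
    { toFun := fun x : BilatHom A.unop Four =>
        (x.comp (show BilatHom B.unop A.unop from h.unop) : BilatHom B.unop Four)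
      monotone' := fun _ _ hxy a => hxy ((show BilatHom B.unop A.unop from h.unop) a)
      continuous_toFun := continuous_induced_rng.2 <| continuous_pi fun a =>
        (continuous_apply (A := fun _ : A.unop => FourK) ((show BilatHom B.unop A.unop from h.unop) a)).comp
          continuous_induced_dom }
  map_id _ := rfl
  map_comp _ _ := rfl

/-- The underlying set of `E(X)`: the continuous order-preserving maps from `X` to the
alter ego of the four-element bilattice. -/
def ECarrier (X : Priestley.{u}) : Type u := X →Co FourK

namespace ECarrier

variable {X : Priestley.{u}}

instance : FunLike (ECarrier X) X Four := inferInstanceAs (FunLike (X →Co FourK) X FourK)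

@[ext]
theorem ext {f g : ECarrier X} (h : ∀ x, f x = g x) : f = g := DFunLike.ext f g h

/-- The pointwise application of a binary operation preserving the knowledge order. -/
def map₂ (o : Four → Four → Four) (ho : ∀ a b c d : Four, infK a b = a → infK c d = c →
    infK (o a c) (o b d) = o a c) (f g : ECarrier X) : ECarrier X where
  toFun x := o (f x) (g x)
  monotone' _ _ h := ho _ _ _ _ (f.monotone' h) (g.monotone' h)
  continuous_toFun :=
    (continuous_of_discreteTopology (β := FourK) (f := fun p : FourK × FourK => o p.1 p.2)).comp
      (f.continuous_toFun.prodMk g.continuous_toFun)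

/-- The pointwise application of a unary operation preserving the knowledge order. -/
def map₁ (o : Four → Four) (ho : ∀ a b : Four, infK a b = a → infK (o a) (o b) = o a)
    (f : ECarrier X) : ECarrier X where
  toFun x := o (f x)
  monotone' _ _ h := ho _ _ (f.monotone' h)
  continuous_toFun :=
    (continuous_of_discreteTopology (α := FourK) (β := FourK) (f := o)).comp
      f.continuous_toFun

/-- Constant maps. -/
def const (b : Four) : ECarrier X where
  toFun _ := (b : FourK)
  monotone' _ _ _ := le_rfl
  continuous_toFun := continuous_const

/-- `E(X)` is a subalgebra of the power `4^X`: the operations are pointwise. -/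
instance : BilatticeOps (ECarrier X) where
  sup := map₂ (· ⊔ ·) (by decide)
  inf := map₂ (· ⊓ ·) (by decide)
  le f g := ∀ x, f x ≤ g x
  le_refl _ _ := le_rfl
  le_trans _ _ _ h h' x := (h x).trans (h' x)
  le_antisymm _ _ h h' := ext fun x => (h x).antisymm (h' x)
  le_sup_left _ _ _ := le_sup_left (α := Four)
  le_sup_right _ _ _ := le_sup_right (α := Four)
  sup_le _ _ _ h h' x := sup_le (α := Four) (h x) (h' x)
  inf_le_left _ _ _ := inf_le_left (α := Four)
  inf_le_right _ _ _ := inf_le_right (α := Four)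
  le_inf _ _ _ h h' x := le_inf (α := Four) (h x) (h' x)
  le_sup_inf _ _ _ _ := le_sup_inf (α := Four)
  bot := const ⊥
  top := const ⊤
  bot_le _ _ := bot_le (α := Four)
  le_top _ _ := le_top (α := Four)
  botK := const botK
  topK := const topK
  neg := map₁ neg (by decide)

instance : DistribBilattice (ECarrier X) :=
  have P := DistribBilattice.preBilattice (A := Four)
  { preBilattice :=
      { lattice_t :=
          { sup_comm := fun _ _ => ext fun _ => P.lattice_t.sup_comm _ _
            inf_comm := fun _ _ => ext fun _ => P.lattice_t.inf_comm _ _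
            sup_assoc := fun _ _ _ => ext fun _ => P.lattice_t.sup_assoc _ _ _
            inf_assoc := fun _ _ _ => ext fun _ => P.lattice_t.inf_assoc _ _ _
            sup_inf_self := fun _ _ => ext fun _ => P.lattice_t.sup_inf_self _ _
            inf_sup_self := fun _ _ => ext fun _ => P.lattice_t.inf_sup_self _ _ }
        lattice_k :=
          { sup_comm := fun _ _ => ext fun _ => P.lattice_k.sup_comm _ _
            inf_comm := fun _ _ => ext fun _ => P.lattice_k.inf_comm _ _
            sup_assoc := fun _ _ _ => ext fun _ => P.lattice_k.sup_assoc _ _ _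
            inf_assoc := fun _ _ _ => ext fun _ => P.lattice_k.inf_assoc _ _ _
            sup_inf_self := fun _ _ => ext fun _ => P.lattice_k.sup_inf_self _ _
            inf_sup_self := fun _ _ => ext fun _ => P.lattice_k.inf_sup_self _ _ }
        sT_iT := fun _ _ _ => ext fun _ => P.sT_iT _ _ _
        sT_sK := fun _ _ _ => ext fun _ => P.sT_sK _ _ _
        sT_iK := fun _ _ _ => ext fun _ => P.sT_iK _ _ _
        iT_sT := fun _ _ _ => ext fun _ => P.iT_sT _ _ _
        iT_sK := fun _ _ _ => ext fun _ => P.iT_sK _ _ _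
        iT_iK := fun _ _ _ => ext fun _ => P.iT_iK _ _ _
        sK_sT := fun _ _ _ => ext fun _ => P.sK_sT _ _ _
        sK_iT := fun _ _ _ => ext fun _ => P.sK_iT _ _ _
        sK_iK := fun _ _ _ => ext fun _ => P.sK_iK _ _ _
        iK_sT := fun _ _ _ => ext fun _ => P.iK_sT _ _ _
        iK_iT := fun _ _ _ => ext fun _ => P.iK_iT _ _ _
        iK_sK := fun _ _ _ => ext fun _ => P.iK_sK _ _ _ }
    supK_botK := fun _ => ext fun _ => DistribBilattice.supK_botK (A := Four) _
    infK_topK := fun _ => ext fun _ => DistribBilattice.infK_topK (A := Four) _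
    neg_neg := fun _ => ext fun _ => DistribBilattice.neg_neg (A := Four) _
    neg_sup := fun _ _ => ext fun _ => DistribBilattice.neg_sup (A := Four) _ _
    neg_inf := fun _ _ => ext fun _ => DistribBilattice.neg_inf (A := Four) _ _
    neg_bot := ext fun _ => DistribBilattice.neg_bot (A := Four)
    neg_top := ext fun _ => DistribBilattice.neg_top (A := Four)
    neg_supK := fun _ _ => ext fun _ => DistribBilattice.neg_supK (A := Four) _ _
    neg_infK := fun _ _ => ext fun _ => DistribBilattice.neg_infK (A := Four) _ _
    neg_botK := ext fun _ => DistribBilattice.neg_botK (A := Four)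
    neg_topK := ext fun _ => DistribBilattice.neg_topK (A := Four) }

end ECarrier

/-- The functor `E = P(-, FourK)` from Priestley spaces to distributive bilattices, acting on
morphisms by `φ ↦ - ∘ φ`. -/
def E : Priestley.{u}ᵒᵖ ⥤ DB.{u} where
  obj X := DB.of (ECarrier X.unop)
  map {X Y} φ :=
    { toFun := fun f : X.unop →Co FourK =>
        (f.comp (show Y.unop →Co X.unop from φ.unop) : Y.unop →Co FourK)
      map_sup' := fun _ _ => rfl
      map_inf' := fun _ _ => rfl
      map_top' := rfl
      map_bot' := rfl
      map_neg' := fun _ => rfl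
      map_botK' := rfl
      map_topK' := rfl }
  map_id _ := rfl
  map_comp _ _ := rfl

/-! ### The functor `V` -/

/-- The underlying set of `V(A)`: the interval `[0ₖ, 1ₜ]` of the truth lattice of `A`. -/
abbrev TInterval (A : Type u) [DistribBilattice A] : Type u := Set.Icc (botK : A) (⊤ : A)

instance (A : Type u) [DistribBilattice A] : Fact ((botK : A) ≤ ⊤) := ⟨le_top⟩

/-- `[0ₖ, 1ₜ]` as a sublattice of the truth lattice.  Its bounds are `0ₖ` and `1ₜ`. -/
instance (A : Type u) [DistribBilattice A] : DistribLattice (TInterval A) :=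
  { Set.Icc.lattice with
    le_sup_inf := fun x y z => le_sup_inf (α := A) (x := x) (y := y) (z := z) }

/-- The functor `V`: `A ↦ [0ₖ, 1ₜ]`, acting on morphisms by restriction. -/
def V : DB.{u} ⥤ BddDistLat.{u} where
  obj A := BddDistLat.of (TInterval A)
  map {A B} h := BddDistLat.ofHom
    { toFun := fun a : TInterval A =>
        (⟨(show BilatHom A B from h) a.1,
          (BilatHom.map_botK (show BilatHom A B from h)).symm.le.trans
            (OrderHomClass.mono (show BilatHom A B from h) a.2.1), le_top⟩ : TInterval B)
      map_sup' := fun a b => Subtype.ext (map_sup (show BilatHom A B from h) a.1 b.1)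
      map_inf' := fun a b => Subtype.ext (map_inf (show BilatHom A B from h) a.1 b.1)
      map_top' := Subtype.ext (map_top (show BilatHom A B from h))
      map_bot' := Subtype.ext (BilatHom.map_botK (show BilatHom A B from h)) }
  map_id _ := rfl
  map_comp _ _ := rfl

/-! ### The functor `W` -/

/-- The universe `L × L` of `L ⊙ L`. -/
@[ext]
structure Odot (L : Type u) : Type u where
  fst : L
  snd : L

namespace Odot

variable {L : Type u} [DistribLattice L] [BoundedOrder L]

/-- The basic operations of `L ⊙ L`; note that `(a₁,a₂) ≤ₜ (b₁,b₂)` iff `a₁ ≤ b₁` and `b₂ ≤ a₂`. -/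
instance : BilatticeOps (Odot L) where
  sup a b := ⟨a.1 ⊔ b.1, a.2 ⊓ b.2⟩
  inf a b := ⟨a.1 ⊓ b.1, a.2 ⊔ b.2⟩
  le a b := a.1 ≤ b.1 ∧ b.2 ≤ a.2
  le_refl _ := ⟨le_rfl, le_rfl⟩
  le_trans _ _ _ h h' := ⟨h.1.trans h'.1, h'.2.trans h.2⟩
  le_antisymm _ _ h h' := Odot.ext (h.1.antisymm h'.1) (h'.2.antisymm h.2)
  le_sup_left _ _ := ⟨le_sup_left, inf_le_left⟩
  le_sup_right _ _ := ⟨le_sup_right, inf_le_right⟩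
  sup_le _ _ _ h h' := ⟨sup_le h.1 h'.1, le_inf h.2 h'.2⟩
  inf_le_left _ _ := ⟨inf_le_left, le_sup_left⟩
  inf_le_right _ _ := ⟨inf_le_right, le_sup_right⟩
  le_inf _ _ _ h h' := ⟨le_inf h.1 h'.1, sup_le h.2 h'.2⟩
  le_sup_inf _ _ _ := ⟨le_sup_inf, (inf_sup_left _ _ _).le⟩
  bot := ⟨⊥, ⊤⟩
  top := ⟨⊤, ⊥⟩
  bot_le _ := ⟨bot_le, le_top⟩
  le_top _ := ⟨le_top, bot_le⟩
  botK := ⟨⊥, ⊥⟩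
  topK := ⟨⊤, ⊤⟩
  neg a := ⟨a.2, a.1⟩

theorem sup_def (a b : Odot L) : a ⊔ b = ⟨a.1 ⊔ b.1, a.2 ⊓ b.2⟩ := rfl
theorem inf_def (a b : Odot L) : a ⊓ b = ⟨a.1 ⊓ b.1, a.2 ⊔ b.2⟩ := rfl
theorem bot_def : (⊥ : Odot L) = ⟨⊥, ⊤⟩ := rfl
theorem top_def : (⊤ : Odot L) = ⟨⊤, ⊥⟩ := rfl
theorem botK_def : (botK : Odot L) = ⟨⊥, ⊥⟩ := rfl
theorem topK_def : (topK : Odot L) = ⟨⊤, ⊤⟩ := rfl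
theorem neg_def (a : Odot L) : neg a = ⟨a.2, a.1⟩ := rfl

/-- The knowledge operations of `L ⊙ L` are componentwise. -/
theorem supK_def (a b : Odot L) : supK a b = ⟨a.1 ⊔ b.1, a.2 ⊔ b.2⟩ := by
  simp [supK, sup_def, inf_def, botK_def, topK_def]

theorem infK_def (a b : Odot L) : infK a b = ⟨a.1 ⊓ b.1, a.2 ⊓ b.2⟩ := by
  simp [infK, sup_def, inf_def, botK_def, topK_def]

/-- `L ⊙ L` is a distributive bilattice. -/
instance : DistribBilattice (Odot L) where
  preBilattice := by
    constructor
    · constructor <;> intros <;>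
        simp [sup_def, inf_def, sup_assoc, inf_assoc] <;> simp [sup_comm, inf_comm]
    · constructor <;> intros <;>
        simp [supK_def, infK_def, sup_assoc, inf_assoc] <;> simp [sup_comm, inf_comm]
    all_goals
      intro a b c
      simp only [supK_def, infK_def, sup_def, inf_def]
      ext <;> first
        | exact sup_inf_left _ _ _
        | exact inf_sup_left _ _ _
        | exact sup_sup_distrib_left _ _ _
        | exact inf_inf_distrib_left _ _ _
  supK_botK a := by simp [supK_def, botK_def]
  infK_topK a := by simp [infK_def, topK_def]
  neg_neg a := rfl
  neg_sup a b := rfl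
  neg_inf a b := rfl
  neg_bot := rfl
  neg_top := rfl
  neg_supK a b := by simp only [supK_def, neg_def]
  neg_infK a b := by simp only [infK_def, neg_def]
  neg_botK := rfl
  neg_topK := rfl

end Odot

/-- The functor `W`: `L ↦ L ⊙ L`, acting on morphisms by `(a, b) ↦ (g a, g b)`. -/
def W : BddDistLat.{u} ⥤ DB.{u} where
  obj L := DB.of (Odot L)
  map {L M} g :=
    { toFun := fun a : Odot L =>
        (⟨BddDistLat.Hom.hom g a.1, BddDistLat.Hom.hom g a.2⟩ : Odot M)
      map_sup' := fun a b => Odot.ext (map_sup (BddDistLat.Hom.hom g) a.1 b.1)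
        (map_inf (BddDistLat.Hom.hom g) a.2 b.2)
      map_inf' := fun a b => Odot.ext (map_inf (BddDistLat.Hom.hom g) a.1 b.1)
        (map_sup (BddDistLat.Hom.hom g) a.2 b.2)
      map_top' := Odot.ext (map_top (BddDistLat.Hom.hom g)) (map_bot (BddDistLat.Hom.hom g))
      map_bot' := Odot.ext (map_bot (BddDistLat.Hom.hom g)) (map_top (BddDistLat.Hom.hom g))
      map_neg' := fun _ => rfl
      map_botK' := Odot.ext (map_bot (BddDistLat.Hom.hom g)) (map_bot (BddDistLat.Hom.hom g))
      map_topK' := Odot.ext (map_top (BddDistLat.Hom.hom g)) (map_top (BddDistLat.Hom.hom g)) }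
  map_id _ := rfl
  map_comp _ _ := rfl

end Bilat

end

noncomputable section

namespace Bilat

open BilatticeOps (botK topK neg)

/-! ### Isomorphisms from bijective homomorphisms -/

/-! Two facts carry the theorem. The first is half of Priestley duality: evaluation `L → KH(L)` is
bijective. It is injective by the prime ideal theorem and surjective by two compactness arguments
(`priestleyEval_injective`, `priestleyEval_surjective`). The second is the product representation `A
≅ V(A) ⊙ V(A)`, given by `a ↦ (a ∨ₜ 0ₖ, ¬a ∨ₜ 0ₖ)` (`toOdot_bijective`).

The bilattice `4` is `2 ⊙ 2` with the second bit complemented, and the knowledge order of `4` raises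
the first bit and lowers the second. A continuous order-preserving map from `X` to the alter ego is
therefore a pair of members of `K(X)`, so that `EH(L)` is `KH(L) ⊙ KH(L)`, hence `L ⊙ L`. By the
product representation, a homomorphism `A → 4` amounts to a homomorphism `[0ₖ, 1ₜ] → 2`: restrict it
and keep the first bit. So the points of `D(A)` are those of `HV(A)`, and `KD(A)` is `KHV(A) ≅
V(A)`.

The equivalence needs no duality. The product representation is the unit, and `[0ₖ, 1ₜ]` in `L ⊙ L`
is `L × {0}`, which gives the counit. Each comparison map is a bijective homomorphism, hence an
isomorphism. -/

theorem BilatHom.isIso_of_bijective {A B : DB.{u}} (f : A ⟶ B)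
    (hf : Function.Bijective (show BilatHom A B from f)) : IsIso f := by
  let F : BilatHom A B := f
  let e : A ≃ B := Equiv.ofBijective F hf
  have he (b : B) : F (e.symm b) = b := e.apply_symm_apply b
  have hi {a : A} {b : B} (h : F a = b) : e.symm b = a := e.symm_apply_eq.2 h.symm
  let G : BilatHom B A :=
    { toFun := e.symm
      map_sup' := fun a b => hi (by rw [map_sup, he, he])
      map_inf' := fun a b => hi (by rw [map_inf, he, he])
      map_top' := hi (map_top F)
      map_bot' := hi (map_bot F)
      map_neg' := fun a => hi (by rw [F.map_neg, he])
      map_botK' := hi F.map_botK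
      map_topK' := hi F.map_topK }
  exact ⟨G, BilatHom.ext fun a => hi rfl, BilatHom.ext he⟩

theorem isIso_of_bijective_hom {L M : BddDistLat.{u}} (f : L ⟶ M)
    (hf : Function.Bijective (BddDistLat.Hom.hom f)) : IsIso f := by
  let F : BoundedLatticeHom L M := BddDistLat.Hom.hom f
  let e : L ≃ M := Equiv.ofBijective F hf
  have he (b : M) : F (e.symm b) = b := e.apply_symm_apply b
  have hi {a : L} {b : M} (h : F a = b) : e.symm b = a := e.symm_apply_eq.2 h.symm
  let G : BoundedLatticeHom M L :=
    { toFun := e.symm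
      map_sup' := fun a b => hi (by rw [map_sup, he, he])
      map_inf' := fun a b => hi (by rw [map_inf, he, he])
      map_top' := hi (map_top F)
      map_bot' := hi (map_bot F) }
  refine ⟨BddDistLat.ofHom G, ?_, ?_⟩
  · ext a; exact hi rfl
  · ext b; exact he b

/-! ### The unit of Priestley duality -/

/-- The filter above `a` and the ideal below `b` are disjoint, so some prime ideal contains `b` and
misses `a`. The indicator of its complement is the required homomorphism, primeness giving
preservation of meets. -/
theorem exists_boundedLatticeHom_separating {L : Type u} [DistribLattice L] [BoundedOrder L]
    {a b : L} (h : ¬ a ≤ b) : ∃ x : BoundedLatticeHom L Bool, x a = true ∧ x b = false := by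
  classical
  obtain ⟨J, hJ, hbJ, hdis⟩ := DistribLattice.prime_ideal_of_disjoint_filter_ideal
    (F := Order.PFilter.principal a) (I := Order.Ideal.principal b)
    (Set.disjoint_left.2 fun c hc hc' => h (le_trans hc hc'))
  have hmem : b ∈ J := hbJ (Order.Ideal.mem_principal_self (x := b))
  have hnot : a ∉ J := fun ha => Set.disjoint_left.1 hdis (le_refl a) ha
  have hsup (c d : L) : c ⊔ d ∈ J ↔ c ∈ J ∧ d ∈ J := Order.Ideal.sup_mem_iff
  have hinf (c d : L) : c ⊓ d ∈ J ↔ c ∈ J ∨ d ∈ J :=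
    ⟨hJ.mem_or_mem, fun h => h.elim (J.lower inf_le_left) (J.lower inf_le_right)⟩
  refine ⟨{ toFun := fun c => !decide (c ∈ J), map_sup' := fun c d => ?_,
            map_inf' := fun c d => ?_, map_top' := ?_, map_bot' := ?_ }, ?_, ?_⟩
  · simp [hsup]
  · simp [hinf]
  · have : (⊤ : L) ∉ J := fun h' => hnot (J.lower le_top h')
    simp [this]
  · simp
  · change (!decide (a ∈ J)) = true
    simp [hnot]
  · change (!decide (b ∈ J)) = false
    simp [hmem]

/-- Evaluation at an element, as a point of `K(H(L))`. -/
def priestleyEval (L : BddDistLat.{u}) (a : L) : KCarrier (Hobj L) where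
  toFun x := (show BoundedLatticeHom L Bool from x) a
  monotone' _ _ h := h a
  continuous_toFun := (continuous_apply a).comp continuous_induced_dom

theorem priestleyEval_injective (L : BddDistLat.{u}) : Function.Injective (priestleyEval L) := by
  have key {a b : L} (h : priestleyEval L a = priestleyEval L b) : a ≤ b := by
    by_contra hab
    obtain ⟨x, ha, hb⟩ := exists_boundedLatticeHom_separating hab
    have hx : x a = x b := DFunLike.congr_fun h (show Hobj L from x)
    simp [ha, hb] at hx
  exact fun a b h => (key h).antisymm (key h.symm)

theorem isOpen_setOf_eval_eq (L : BddDistLat.{u}) (a : L) (t : Bool) :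
    IsOpen {x : Hobj L | priestleyEval L a x = t} :=
  (isOpen_discrete {t}).preimage (priestleyEval L a).continuous_toFun

theorem priestleyEval_inf (L : BddDistLat.{u}) (a b : L) (x : Hobj L) :
    priestleyEval L (a ⊓ b) x = (priestleyEval L a x ⊓ priestleyEval L b x) :=
  map_inf (show BoundedLatticeHom L Bool from x) a b

theorem priestleyEval_sup (L : BddDistLat.{u}) (a b : L) (x : Hobj L) :
    priestleyEval L (a ⊔ b) x = (priestleyEval L a x ⊔ priestleyEval L b x) :=
  map_sup (show BoundedLatticeHom L Bool from x) a b

theorem exists_priestleyEval_eq_true_eq_false (L : BddDistLat.{u}) {x y : Hobj L}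
    (h : ¬ x ≤ y) : ∃ a, priestleyEval L a x = true ∧ priestleyEval L a y = false := by
  obtain ⟨a, ha⟩ := not_forall.1 (show ¬ ∀ a, priestleyEval L a x ≤ priestleyEval L a y from h)
  refine ⟨a, ?_⟩
  revert ha
  cases priestleyEval L a x <;> cases priestleyEval L a y <;> decide

theorem isCompact_setOf_eq {X : Priestley.{u}} (f : KCarrier X) (t : Bool) :
    IsCompact {x : X | f x = t} :=
  ((isClosed_discrete {t}).preimage f.continuous_toFun).isCompact

/-- First compactness argument, with `x` fixed. If `f y = false`, then `x ≰ y` since `f` is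
monotone, so some `a` is true at `x` and false at `y`. The open sets where such `a` are false cover
the compact set where `f` is false. They are directed, by taking meets, so a single `a` suffices. -/
theorem exists_priestleyEval_le (L : BddDistLat.{u}) (f : KCarrier (Hobj L)) (x : Hobj L)
    (hx : f x = true) :
    ∃ a, priestleyEval L a x = true ∧ ∀ y, f y = false → priestleyEval L a y = false := by
  have : Nonempty {a : L // priestleyEval L a x = true} :=
    ⟨⊤, map_top (show BoundedLatticeHom L Bool from x)⟩
  have hcov : {y | f y = false} ⊆
      ⋃ a : {a : L // priestleyEval L a x = true}, {y | priestleyEval L a.1 y = false} := by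
    intro y hy
    have hxy : ¬ x ≤ y := fun h => by
      have := f.monotone' h
      change f x ≤ f y at this
      rw [hx, show f y = false from hy] at this
      exact absurd this (by decide)
    obtain ⟨a, hax, hay⟩ := exists_priestleyEval_eq_true_eq_false L hxy
    exact Set.mem_iUnion.2 ⟨⟨a, hax⟩, hay⟩
  have hdir : Directed (· ⊆ ·) fun a : {a : L // priestleyEval L a x = true} =>
      {y | priestleyEval L a.1 y = false} := by
    rintro ⟨a, ha⟩ ⟨b, hb⟩
    refine ⟨⟨a ⊓ b, by rw [priestleyEval_inf, ha, hb]; rfl⟩, fun y hy => ?_, fun y hy => ?_⟩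
    all_goals
      simp only [Set.mem_ofPred_eq] at hy ⊢
      simp [priestleyEval_inf, hy]
  obtain ⟨⟨a, ha⟩, hsub⟩ := (isCompact_setOf_eq f false).elim_directed_cover _
    (fun a : {a : L // priestleyEval L a x = true} => isOpen_setOf_eval_eq L a.1 false) hcov hdir
  exact ⟨a, ha, fun y hy => hsub hy⟩

/-- Second compactness argument, dual to `exists_priestleyEval_le`. That lemma says that the
elements whose evaluation lies below `f` cover the compact set where `f` is true. They are directed
under joins, so one of them covers it alone and its evaluation equals `f`. -/
theorem priestleyEval_surjective (L : BddDistLat.{u}) : Function.Surjective (priestleyEval L) := by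
  intro f
  have : Nonempty {a : L // ∀ y, f y = false → priestleyEval L a y = false} :=
    ⟨⊥, fun y _ => map_bot (show BoundedLatticeHom L Bool from y)⟩
  have hcov : {x | f x = true} ⊆
      ⋃ a : {a : L // ∀ y, f y = false → priestleyEval L a y = false},
        {y | priestleyEval L a.1 y = true} := by
    intro x hx
    obtain ⟨a, ha, h⟩ := exists_priestleyEval_le L f x hx
    exact Set.mem_iUnion.2 ⟨⟨a, h⟩, ha⟩
  have hdir : Directed (· ⊆ ·)
      fun a : {a : L // ∀ y, f y = false → priestleyEval L a y = false} =>
        {y | priestleyEval L a.1 y = true} := by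
    rintro ⟨a, ha⟩ ⟨b, hb⟩
    refine ⟨⟨a ⊔ b, fun y hy => by rw [priestleyEval_sup, ha y hy, hb y hy]; rfl⟩,
      fun y hy => ?_, fun y hy => ?_⟩
    all_goals
      simp only [Set.mem_ofPred_eq] at hy ⊢
      simp [priestleyEval_sup, hy]
  obtain ⟨⟨a, ha⟩, hsub⟩ := (isCompact_setOf_eq f true).elim_directed_cover _
    (fun a : {a : L // ∀ y, f y = false → priestleyEval L a y = false} =>
      isOpen_setOf_eval_eq L a.1 true) hcov hdir
  refine ⟨a, DFunLike.ext _ _ fun x => ?_⟩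
  cases hx : f x
  · exact ha x hx
  · exact hsub hx

/-! ### The natural isomorphism between `W` and `EH` -/

theorem fourK_le_iff (a b : FourK) : a ≤ b ↔ a.1 ≤ b.1 ∧ b.2 ≤ a.2 := by
  have : ∀ a b : Four, infK a b = a ↔ a.1 ≤ b.1 ∧ b.2 ≤ a.2 := by decide
  exact this a b

/-- The homomorphism `(a, b) ↦ (y a, ¬ y b)` from `L ⊙ L` to the four-element bilattice. -/
def odotHom {L : Type u} [DistribLattice L] [BoundedOrder L] (y : BoundedLatticeHom L Bool) :
    BilatHom (Odot L) Four where
  -- The truth order of `L ⊙ L` is reversed in the second coordinate, while that of the four-element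
  -- bilattice is componentwise; hence the complement.
  toFun a := (y a.1, !y a.2)
  map_sup' a b := Prod.ext (map_sup y _ _) (by
    change (!y (a.2 ⊓ b.2)) = ((!y a.2) || !y b.2)
    rw [map_inf]; exact Bool.not_and _ _)
  map_inf' a b := Prod.ext (map_inf y _ _) (by
    change (!y (a.2 ⊔ b.2)) = ((!y a.2) && !y b.2)
    rw [map_sup]; exact Bool.not_or _ _)
  map_top' := Prod.ext (map_top y) (congrArg Bool.not (map_bot y))
  map_bot' := Prod.ext (map_bot y) (congrArg Bool.not (map_top y))
  map_neg' a := Prod.ext (Bool.not_not (y a.2)).symm rfl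
  map_botK' := Prod.ext (map_bot y) (congrArg Bool.not (map_bot y))
  map_topK' := Prod.ext (map_top y) (congrArg Bool.not (map_top y))

/-- Evaluation at a pair, as a point of `E(H(L))`. -/
def odotEvalPoint (L : BddDistLat.{u}) (a : Odot L) : ECarrier (Hobj L) where
  toFun x := (odotHom (show BoundedLatticeHom L Bool from x) a : Four)
  monotone' x y h := (fourK_le_iff _ _).2 ⟨h a.1, by
    have := h a.2
    change (!(show BoundedLatticeHom L Bool from y) a.2) ≤
      !(show BoundedLatticeHom L Bool from x) a.2
    change (show BoundedLatticeHom L Bool from x) a.2 ≤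
      (show BoundedLatticeHom L Bool from y) a.2 at this
    revert this
    generalize (show BoundedLatticeHom L Bool from x) a.2 = s
    generalize (show BoundedLatticeHom L Bool from y) a.2 = t
    revert s t
    decide⟩
  continuous_toFun :=
    (continuous_of_discreteTopology (α := Bool × Bool) (β := FourK)
      (f := fun p => (p.1, !p.2))).comp
      ((priestleyEval L a.1).continuous_toFun.prodMk (priestleyEval L a.2).continuous_toFun)

/-- Evaluation as a homomorphism `L ⊙ L → E(H(L))`. -/
def odotEval (L : BddDistLat.{u}) : BilatHom (Odot L) (ECarrier (Hobj L)) where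
  toFun := odotEvalPoint L
  map_sup' a b := ECarrier.ext fun x => map_sup (odotHom (show BoundedLatticeHom L Bool from x)) a b
  map_inf' a b := ECarrier.ext fun x => map_inf (odotHom (show BoundedLatticeHom L Bool from x)) a b
  map_top' := ECarrier.ext fun x => map_top (odotHom (show BoundedLatticeHom L Bool from x))
  map_bot' := ECarrier.ext fun x => map_bot (odotHom (show BoundedLatticeHom L Bool from x))
  map_neg' a := ECarrier.ext fun x => (odotHom (show BoundedLatticeHom L Bool from x)).map_neg a
  map_botK' := ECarrier.ext fun x => (odotHom (show BoundedLatticeHom L Bool from x)).map_botK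
  map_topK' := ECarrier.ext fun x => (odotHom (show BoundedLatticeHom L Bool from x)).map_topK

/-- Postcomposition of a continuous monotone map to `FourK` with a knowledge-monotone map. -/
def ECarrier.toK {X : Priestley.{u}} (o : Four → Bool)
    (ho : ∀ a b : Four, infK a b = a → o a ≤ o b) (f : ECarrier X) : KCarrier X where
  toFun x := o (f x)
  monotone' _ _ h := ho _ _ (f.monotone' h)
  continuous_toFun :=
    (continuous_of_discreteTopology (α := FourK) (β := Bool) (f := o)).comp f.continuous_toFun

/-- The first bit and the complement of the second bit are both monotone for the knowledge order. A
point of `E(H(L))` thus splits into two points of `K(H(L))`, and Priestley duality applies to each.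
-/
theorem odotEval_bijective (L : BddDistLat.{u}) : Function.Bijective (odotEval L) := by
  constructor
  · intro a b h
    refine Odot.ext (priestleyEval_injective L (DFunLike.ext _ _ fun x => ?_))
      (priestleyEval_injective L (DFunLike.ext _ _ fun x => ?_))
    · exact congrArg Prod.fst (DFunLike.congr_fun h x)
    · exact Bool.not_inj (congrArg Prod.snd (DFunLike.congr_fun h x))
  · intro f
    obtain ⟨a, ha⟩ := priestleyEval_surjective L (f.toK (fun p => p.1) (by decide))
    obtain ⟨b, hb⟩ := priestleyEval_surjective L (f.toK (fun p => !p.2) (by decide))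
    refine ⟨⟨a, b⟩, ECarrier.ext fun x => Prod.ext (DFunLike.congr_fun ha x) ?_⟩
    have := congrArg Bool.not (DFunLike.congr_fun hb x)
    exact this.trans (Bool.not_not _)

/-- `W` is naturally isomorphic to `EH`. -/
def isoWEH : W.{u} ≅ H.{u}.rightOp ⋙ E.{u} :=
  NatIso.ofComponents
    (fun L =>
      haveI := BilatHom.isIso_of_bijective (A := W.obj L) (B := (H.rightOp ⋙ E).obj L)
        (odotEval L) (odotEval_bijective L)
      asIso (X := W.obj L) (Y := (H.rightOp ⋙ E).obj L) (odotEval L))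
    -- Naturality: evaluating `x` at the image under `g` and evaluating `x ∘ g` are the same by
    -- definition.
    (fun _ => rfl)

/-! ### The product representation -/

section Representation

variable (A : Type u) [DistribBilattice A]

/-- This is `1ₜ ∧ₖ 1ₖ = 1ₜ` with the definition of `∧ₖ` expanded. -/
theorem topK_sup_botK : (topK : A) ⊔ botK = ⊤ := by
  simpa [infK] using DistribBilattice.infK_topK (⊤ : A)

variable {A}

/-- The component `a ∨ₜ 0ₖ` of `a` in the interval `[0ₖ, 1ₜ]`. -/
def supBotK (a : A) : TInterval A := ⟨a ⊔ botK, le_sup_right, le_top⟩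

theorem neg_le_botK {a : A} (h : botK ≤ a) : neg a ≤ botK := by
  have := DistribBilattice.neg_sup (botK : A) a
  rw [sup_eq_right.2 h, DistribBilattice.neg_botK] at this
  exact this ▸ inf_le_left

/-- Negating `¬c ∨ₜ 0ₖ` gives `c ∧ₜ 0ₖ`, so the hypotheses fix both the join and the meet with `0ₖ`.
In a distributive lattice these determine the element. -/
theorem eq_of_supBotK_eq {a b : A} (h₁ : supBotK a = supBotK b)
    (h₂ : supBotK (neg a) = supBotK (neg b)) : a = b := by
  have h : ∀ c : A, neg (neg c ⊔ botK) = c ⊓ botK := fun c => by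
    rw [DistribBilattice.neg_sup, DistribBilattice.neg_neg, DistribBilattice.neg_botK]
  refine eq_of_inf_eq_sup_eq (a := botK) ?_ (congrArg Subtype.val h₁)
  rw [← h, ← h]
  exact congrArg neg (congrArg Subtype.val h₂)

variable (A)

/-- The homomorphism `a ↦ (a ∨ₜ 0ₖ, ¬a ∨ₜ 0ₖ)` from `A` to `[0ₖ, 1ₜ] ⊙ [0ₖ, 1ₜ]`. -/
def toOdot : BilatHom A (Odot (TInterval A)) where
  toFun a := ⟨supBotK a, supBotK (neg a)⟩
  map_sup' a b := Odot.ext (Subtype.ext (sup_sup_distrib_right a b botK)) (Subtype.ext (by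
    change neg (a ⊔ b) ⊔ botK = (neg a ⊔ botK) ⊓ (neg b ⊔ botK)
    rw [DistribBilattice.neg_sup, sup_inf_right]))
  map_inf' a b := Odot.ext (Subtype.ext (sup_inf_right a b botK)) (Subtype.ext (by
    change neg (a ⊓ b) ⊔ botK = (neg a ⊔ botK) ⊔ (neg b ⊔ botK)
    rw [DistribBilattice.neg_inf, sup_sup_distrib_right]))
  map_top' := Odot.ext (Subtype.ext (top_sup_eq _)) (Subtype.ext (by
    change neg ⊤ ⊔ botK = (botK : A)
    rw [DistribBilattice.neg_top, bot_sup_eq]))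
  map_bot' := Odot.ext (Subtype.ext (bot_sup_eq _)) (Subtype.ext (by
    change neg ⊥ ⊔ botK = (⊤ : A)
    rw [DistribBilattice.neg_bot, top_sup_eq]))
  map_neg' a := Odot.ext rfl (congrArg supBotK (DistribBilattice.neg_neg a))
  map_botK' := Odot.ext (Subtype.ext (sup_idem _)) (Subtype.ext (by
    change neg botK ⊔ botK = (botK : A)
    rw [DistribBilattice.neg_botK, sup_idem]))
  map_topK' := Odot.ext (Subtype.ext (topK_sup_botK A)) (Subtype.ext (by
    change neg topK ⊔ botK = (⊤ : A)
    rw [DistribBilattice.neg_topK, topK_sup_botK]))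

theorem toOdot_bijective : Function.Bijective (toOdot A) := by
  constructor
  · exact fun a b h => eq_of_supBotK_eq (congrArg Odot.fst h) (congrArg Odot.snd h)
  · rintro ⟨⟨p, hp, _⟩, ⟨q, hq, _⟩⟩
    -- The witness is read off from `L ⊙ L`: for `p = (r, 0)` and `q = (s, 0)`, one has `¬q ∨ₜ 1ₖ =
    -- (1, s)`, and its truth meet with `p` is `(r, s)`.
    refine ⟨p ⊓ (neg q ⊔ topK), Odot.ext (Subtype.ext ?_) (Subtype.ext ?_)⟩
    · change (p ⊓ (neg q ⊔ topK)) ⊔ botK = p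
      rw [sup_inf_right, sup_assoc, topK_sup_botK, sup_top_eq, inf_top_eq, sup_eq_left.2 hp]
    · change neg (p ⊓ (neg q ⊔ topK)) ⊔ botK = q
      rw [DistribBilattice.neg_inf, DistribBilattice.neg_sup, DistribBilattice.neg_neg,
        DistribBilattice.neg_topK, sup_right_comm, sup_eq_right.2 (neg_le_botK hp), sup_comm,
        sup_inf_right, topK_sup_botK, inf_top_eq, sup_eq_left.2 hq]

end Representation

/-! ### The equivalence given by `V` and `W` -/

/-- The unit: `A` is naturally isomorphic to `W(V(A))`. -/
def unitVW : 𝟭 DB.{u} ≅ V.{u} ⋙ W.{u} :=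
  NatIso.ofComponents
    (fun A =>
      haveI := BilatHom.isIso_of_bijective (A := A) (B := (V ⋙ W).obj A)
        (toOdot A) (toOdot_bijective A)
      asIso (X := A) (Y := (V ⋙ W).obj A) (toOdot A))
    (fun {A B} h => by
      let h' : BilatHom A B := h
      refine BilatHom.ext fun a => Odot.ext (Subtype.ext ?_) (Subtype.ext ?_)
      · change h' a ⊔ botK = h' (a ⊔ botK)
        rw [map_sup, h'.map_botK]
      · change neg (h' a) ⊔ botK = h' (neg a ⊔ botK)
        rw [map_sup, h'.map_botK, h'.map_neg])

/-- The first projection from the interval `[0ₖ, 1ₜ]` of `L ⊙ L` to `L`. -/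
def intervalFst (L : Type u) [DistribLattice L] [BoundedOrder L] :
    BoundedLatticeHom (TInterval (Odot L)) L where
  toFun a := a.1.fst
  map_sup' _ _ := rfl
  map_inf' _ _ := rfl
  map_top' := rfl
  map_bot' := rfl

/-- Since the truth order is reversed in the second coordinate, lying above `0ₖ = (0, 0)` forces
that coordinate to be `0`. -/
theorem intervalFst_bijective (L : Type u) [DistribLattice L] [BoundedOrder L] :
    Function.Bijective (intervalFst L) := by
  have hsnd (a : TInterval (Odot L)) : a.1.snd = ⊥ := le_bot_iff.1 a.2.1.2
  constructor
  · exact fun a b h => Subtype.ext (Odot.ext h ((hsnd a).trans (hsnd b).symm))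
  · exact fun a => ⟨⟨⟨a, ⊥⟩, ⟨bot_le, le_rfl⟩, le_top⟩, rfl⟩

/-- The counit: `V(W(L))` is naturally isomorphic to `L`. -/
def counitVW : W.{u} ⋙ V.{u} ≅ 𝟭 BddDistLat.{u} :=
  NatIso.ofComponents
    (fun L =>
      haveI := isIso_of_bijective_hom (L := (W ⋙ V).obj L) (M := L)
        (BddDistLat.ofHom (intervalFst L)) (intervalFst_bijective L)
      asIso (X := (W ⋙ V).obj L) (Y := L) (BddDistLat.ofHom (intervalFst L)))
    (fun _ => rfl)

/-! ### The natural isomorphism between `V` and `KD` -/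

section Dual

variable (A : DB.{u})

/-- Evaluation of the first coordinate at an element of `[0ₖ, 1ₜ]`, as a point of `K(D(A))`. -/
def intervalEvalPoint (a : TInterval A) : KCarrier (Dobj A) where
  toFun x := ((show BilatHom A Four from x) a.1).1
  monotone' _ _ h := ((fourK_le_iff _ _).1 (h a.1)).1
  continuous_toFun :=
    (continuous_of_discreteTopology (α := FourK) (β := Bool) (f := fun p => p.1)).comp
      ((continuous_apply (A := fun _ : A => FourK) a.1).comp continuous_induced_dom)

/-- Evaluation as a homomorphism `V(A) → K(D(A))`. -/
def intervalEval : BoundedLatticeHom (TInterval A) (KCarrier (Dobj A)) where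
  toFun := intervalEvalPoint A
  map_sup' a b := DFunLike.ext _ _ fun x =>
    congrArg (fun p : Four => p.1) (map_sup (show BilatHom A Four from x) a.1 b.1)
  map_inf' a b := DFunLike.ext _ _ fun x =>
    congrArg (fun p : Four => p.1) (map_inf (show BilatHom A Four from x) a.1 b.1)
  map_top' := DFunLike.ext _ _ fun x => congrArg (fun p : Four => p.1) (map_top (show BilatHom A Four from x))
  map_bot' := DFunLike.ext _ _ fun x =>
    congrArg (fun p : Four => p.1) (show BilatHom A Four from x).map_botK

/-- The extension of `y : [0ₖ, 1ₜ] → 2` to a homomorphism from `A` to the four-element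
bilattice. -/
def extendHom (y : BoundedLatticeHom (TInterval A) Bool) : BilatHom A Four :=
  (odotHom y).comp (toOdot A)

/-- The restriction of `x : A → 4` to `[0ₖ, 1ₜ]`, followed by the first projection. -/
def restrictHom (x : BilatHom A Four) : BoundedLatticeHom (TInterval A) Bool where
  toFun a := (x a.1).1
  map_sup' a b := congrArg (fun p : Four => p.1) (map_sup x a.1 b.1)
  map_inf' a b := congrArg (fun p : Four => p.1) (map_inf x a.1 b.1)
  map_top' := congrArg (fun p : Four => p.1) (map_top x)
  map_bot' := congrArg (fun p : Four => p.1) x.map_botK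

theorem extendHom_fst (y : BoundedLatticeHom (TInterval A) Bool) (a : TInterval A) :
    (extendHom A y a.1).1 = y a :=
  congrArg y (Subtype.ext (sup_eq_left.2 a.2.1))

/-- Joining with `0ₖ = 01` leaves the first bit unchanged, and the first bit of `¬c` is the
complement of the second bit of `c`. Both bits of `x a` are therefore recovered from first bits on
`[0ₖ, 1ₜ]`. -/
theorem extendHom_restrictHom (x : BilatHom A Four) : extendHom A (restrictHom A x) = x := by
  refine BilatHom.ext fun a => ?_
  have h : ∀ c : Four, (c ⊔ botK).1 = c.1 ∧ (!(neg c ⊔ botK).1) = c.2 := by decide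
  refine Prod.ext ?_ ?_
  · change (x (a ⊔ botK)).1 = (x a).1
    rw [map_sup, x.map_botK, (h _).1]
  · change (!(x (neg a ⊔ botK)).1) = (x a).2
    rw [map_sup, x.map_neg, x.map_botK, (h _).2]

/-- Extension as a morphism `H(V(A)) → D(A)`. -/
def extendMap : Hobj (V.obj A) →Co Dobj A where
  toFun y := extendHom A y
  -- For fixed `a`, the value of the extension at `a` is, as a function of `y`, a point of
  -- `E(H(V(A)))`; monotonicity and continuity are inherited from it coordinatewise.
  monotone' _ _ h a := (odotEvalPoint (V.obj A) (toOdot A a)).monotone' h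
  continuous_toFun := continuous_induced_rng.2 <| continuous_pi fun a =>
    (odotEvalPoint (V.obj A) (toOdot A a)).continuous_toFun

/-- Transfer of Priestley duality for `V(A)` along `extendMap`. Injectivity holds because extensions
keep their values on the interval. For surjectivity, `f ∘ extendMap` is evaluation at some `a`, and
every `x` is the extension of its restriction. Continuity of restriction is not needed. -/
theorem intervalEval_bijective : Function.Bijective (intervalEval A) := by
  constructor
  · intro a b h
    refine priestleyEval_injective (V.obj A) (DFunLike.ext _ _ fun y => ?_)
    have := DFunLike.congr_fun h (extendMap A y)
    exact (extendHom_fst A y a).symm.trans (this.trans (extendHom_fst A y b))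
  · intro f
    obtain ⟨a, ha⟩ := priestleyEval_surjective (V.obj A)
      (show KCarrier (Hobj (V.obj A)) from ContinuousOrderHom.comp f (extendMap A))
    refine ⟨a, DFunLike.ext _ _ fun x => ?_⟩
    have h := DFunLike.congr_fun ha (restrictHom A x)
    exact h.trans (congrArg (fun z : Dobj A => f z) (extendHom_restrictHom A x))

end Dual

/-- `V` is naturally isomorphic to `KD`. -/
def isoVKD : V.{u} ≅ D.{u}.rightOp ⋙ K.{u} :=
  NatIso.ofComponents
    (fun A =>
      haveI := isIso_of_bijective_hom (L := V.obj A) (M := (D.rightOp ⋙ K).obj A)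
        (BddDistLat.ofHom (intervalEval A)) (intervalEval_bijective A)
      asIso (X := V.obj A) (Y := (D.rightOp ⋙ K).obj A) (BddDistLat.ofHom (intervalEval A)))
    (fun _ => rfl)

end Bilat

end

theorem theorem7p2 :
    Nonempty (Bilat.V.{u} ≅ Bilat.D.{u}.rightOp ⋙ Bilat.K.{u}) ∧
    Nonempty (Bilat.W.{u} ≅ Bilat.H.{u}.rightOp ⋙ Bilat.E.{u}) ∧
    ∃ e : Bilat.DB.{u} ≌ BddDistLat.{u}, e.functor = Bilat.V ∧ e.inverse = Bilat.W :=
  ⟨⟨Bilat.isoVKD⟩, ⟨Bilat.isoWEH⟩,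
    -- No triangle identity has to be checked: `Equivalence.mk` adjusts the unit to obtain it and
    -- leaves the two functors unchanged.
    CategoryTheory.Equivalence.mk Bilat.V Bilat.W Bilat.unitVW Bilat.counitVW, rfl, rfl⟩
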